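/- Let $G=(V,E)$ be an infinite connected (simple) graph and let $d\in\mathbb N$ be such that every vertex of $G$ has degree at most $d$. For $o\in V$ let $P_o$ (with expectation $E_o$) be the law of the simple random walk $(X_n)_{n\ge 0}$ on $G$ started at $X_0=o$, that is, of the Markov chain with transition probabilities $p(x,y)=1/\deg(x)$ if $y$ is a neighbour of $x$ and $p(x,y)=0$ otherwise. Let $R_n=\{X_0,X_1,\dots,X_n\}$ be the set of vertices visited in the first $n$ steps, let $|R_n|$ be its cardinality, and let $$\mathrm{Ent}_o(R_n)=E_o\Bigl[\log\frac{1}{p_o(R_n)}\Bigr],\qquad p_o(A)=P_o[R_n=A]\quad\text{for finite } A\subseteq V,$$ be the entropy of $R_n$. Then $$\limsup_{n\to\infty}\ \sup_{o\in V}\ \frac{\mathrm{Ent}_o(R_n)}{E_o[|R_n|]}\ \le\ 2\log d .$$ -/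

import Mathlib

open MeasureTheory ProbabilityTheory Filter
open scoped ENNReal

noncomputable section

namespace SimpleGraph

/-- The one-step distribution `p(x, ·)` of the simple random walk on a locally finite graph:
mass `1 / deg x` on every neighbour `y` of `x`, and no mass elsewhere.
(An isolated vertex is made absorbing, so that `p(x, ·)` is always a probability measure; a
connected graph with at least two vertices has no isolated vertex.) -/
def stepMeasure {V : Type*} [MeasurableSpace V] (G : SimpleGraph V) [G.LocallyFinite] (x : V) :
    Measure V :=
  if G.degree x = 0 then Measure.dirac x
  else ∑ y ∈ G.neighborFinset x, (G.degree x : ℝ≥0∞)⁻¹ • Measure.dirac y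

instance isProbabilityMeasure_stepMeasure {V : Type*} [MeasurableSpace V] (G : SimpleGraph V)
    [G.LocallyFinite] (x : V) : IsProbabilityMeasure (G.stepMeasure x) := by
  unfold stepMeasure
  split_ifs with h
  · infer_instance
  · refine ⟨?_⟩
    simp [Measure.finsetSum_apply, ENNReal.mul_inv_cancel, h]

/-- The one-step distributions as a Markov kernel on the vertex set. -/
def stepKernel {V : Type*} [MeasurableSpace V] [DiscreteMeasurableSpace V] (G : SimpleGraph V)
    [G.LocallyFinite] : Kernel V V where
  toFun := G.stepMeasure
  measurable' := Measurable.of_discrete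

instance isMarkovKernel_stepKernel {V : Type*} [MeasurableSpace V] [DiscreteMeasurableSpace V]
    (G : SimpleGraph V) [G.LocallyFinite] : IsMarkovKernel G.stepKernel :=
  ⟨fun x => G.isProbabilityMeasure_stepMeasure x⟩

/-- The law of `X (n + 1)` given the trajectory `X 0, …, X n`: it is `p(X n, ·)`. -/
def walkKernel {V : Type*} [MeasurableSpace V] [DiscreteMeasurableSpace V] (G : SimpleGraph V)
    [G.LocallyFinite] (n : ℕ) : Kernel (Finset.Iic n → V) V :=
  G.stepKernel.comap (fun x => x ⟨n, Finset.mem_Iic.2 le_rfl⟩) (measurable_pi_apply _)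

instance isMarkovKernel_walkKernel {V : Type*} [MeasurableSpace V] [DiscreteMeasurableSpace V]
    (G : SimpleGraph V) [G.LocallyFinite] (n : ℕ) : IsMarkovKernel (G.walkKernel n) := by
  unfold walkKernel
  infer_instance

/-- The law `P_o` on `ℕ → V` (with the product σ-algebra) of the simple random walk on `G`
started at `o`: the Markov chain with `X 0 = o` and transition probabilities `p(x, y)`. -/
def walkLaw {V : Type*} [MeasurableSpace V] [DiscreteMeasurableSpace V] (G : SimpleGraph V)
    [G.LocallyFinite] (o : V) : Measure (ℕ → V) :=
  Kernel.traj (X := fun _ : ℕ => V) G.walkKernel 0 (fun _ => o)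

end SimpleGraph

/-- The range `{ω 0, ω 1, …, ω n}` of a trajectory `ω` in its first `n` steps. -/
def walkRange {V : Type*} (n : ℕ) (ω : ℕ → V) : Finset V :=
  open Classical in (Finset.range (n + 1)).image ω

/-- The entropy `E[log (1 / p(X))]`, `p(x) = P[X = x]`, of a discrete random variable `X`.
The integrand is nonnegative, so the expectation is taken in `[0, ∞]`. -/
def shannonEntropy {Ω S : Type*} [MeasurableSpace Ω] (P : Measure Ω) (X : Ω → S) : ℝ≥0∞ :=
  ∫⁻ ω, ENNReal.ofReal (Real.log (1 / P.real {ω' | X ω' = X ω})) ∂P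

/-- The expected size `E_o |R_n|` of the range of the simple random walk started at `o`. -/
def SimpleGraph.expectedRange {V : Type*} [MeasurableSpace V] [DiscreteMeasurableSpace V]
    (G : SimpleGraph V) [G.LocallyFinite] (n : ℕ) (o : V) : ℝ≥0∞ :=
  ∫⁻ ω, ((walkRange n ω).card : ℝ≥0∞) ∂(G.walkLaw o)

/-- The entropy `Ent_o(R_n)` of the range of the simple random walk started at `o`. -/
def SimpleGraph.rangeEntropy {V : Type*} [MeasurableSpace V] [DiscreteMeasurableSpace V]
    (G : SimpleGraph V) [G.LocallyFinite] (n : ℕ) (o : V) : ℝ≥0∞ :=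
  shannonEntropy (G.walkLaw o) (walkRange n)

end

/-! By Gibbs' inequality, entropy is at most the mean of `-log q(R_n)` for any subprobability `q` on
finite sets. Take for `q` the law of `R_{2K}`, where `K` is an independent geometric variable with
ratio `e^{-ε}`. A range with `N` vertices is exactly the support of a walk from `o` of length `2 (N
- 1)`, the contour of a spanning tree, and each step of it has probability at least `1/d`. Hence
`-log q(R_n) ≤ C_ε + (2 log d + ε) |R_n|` almost surely, with `C_ε = -log (1 - e^{-ε})`, which gives
`rangeEntropy_le`.

The constant `C_ε` disappears after division because `E_o |R_n|` tends to infinity uniformly in `o`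
(`eventually_le_expectedRange`): in any `k` steps, whatever the past, the walk follows a
self-avoiding path with probability at least `d^{-k}`. -/

/-! ### Gibbs' inequality -/

/-- This is `log t ≤ t - 1` at `t = exp (-f) / P[X = s]`, integrated; the mean of `q / P[X = s]` is
at most the total mass of `q`. -/
theorem shannonEntropy_le_lintegral {Ω S : Type*} [MeasurableSpace Ω] [Countable S]
    [MeasurableSpace S] [MeasurableSingletonClass S] (P : Measure Ω) [IsProbabilityMeasure P]
    {X : Ω → S} (hX : Measurable X) {q : S → ℝ≥0∞} (hq : ∑' s, q s ≤ 1) {f : S → ℝ}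
    (hf : ∀ s, 0 ≤ f s) (h : ∀ᵐ ω ∂P, ENNReal.ofReal (Real.exp (-f (X ω))) ≤ q (X ω)) :
    shannonEntropy P X ≤ ∫⁻ ω, ENNReal.ofReal (f (X ω)) ∂P := by
  have hpos : ∀ᵐ ω ∂P, P (X ⁻¹' {X ω}) ≠ 0 := by
    have : ∀ᵐ ω ∂P, ∀ s, X ω = s → P (X ⁻¹' {s}) ≠ 0 := by
      refine ae_all_iff.2 fun s => ?_
      by_cases hs : P (X ⁻¹' {s}) = 0
      · have : ∀ᵐ ω ∂P, ω ∉ X ⁻¹' {s} := measure_eq_zero_iff_ae_notMem.1 hs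
        filter_upwards [this] with ω hω h
        exact absurd h hω
      · exact ae_of_all _ fun ω _ => hs
    filter_upwards [this] with ω hω using hω _ rfl
  have hm (g : S → ℝ≥0∞) : Measurable fun ω => g (X ω) := (measurable_of_countable g).comp hX
  -- The added `1` keeps every term nonnegative, so that no subtraction occurs in `[0, ∞]`.
  have hle : shannonEntropy P X + 1 ≤ ∫⁻ ω, ENNReal.ofReal (f (X ω)) ∂P + 1 := by
    calc shannonEntropy P X + 1
        = ∫⁻ ω, (ENNReal.ofReal (Real.log (1 / P.real {ω' | X ω' = X ω})) + 1) ∂P := by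
          rw [lintegral_add_right _ measurable_const]
          simp [shannonEntropy]
      _ ≤ ∫⁻ ω, (ENNReal.ofReal (f (X ω)) + q (X ω) / P (X ⁻¹' {X ω})) ∂P := by
          refine lintegral_mono_ae ?_
          filter_upwards [hpos, h] with ω hω hqω
          have hp : 0 < P.real (X ⁻¹' {X ω}) :=
            ENNReal.toReal_pos hω (measure_ne_top _ _)
          have hp1 : P.real (X ⁻¹' {X ω}) ≤ 1 := measureReal_le_one
          have heq : {ω' | X ω' = X ω} = X ⁻¹' {X ω} := rfl
          rw [heq]
          have hlog : Real.log (1 / P.real (X ⁻¹' {X ω})) + 1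
              ≤ f (X ω) + Real.exp (-f (X ω)) / P.real (X ⁻¹' {X ω}) := by
            have := Real.log_le_sub_one_of_pos (div_pos (Real.exp_pos (-f (X ω))) hp)
            rw [Real.log_div (Real.exp_pos _).ne' hp.ne', Real.log_exp] at this
            rw [one_div, Real.log_inv]
            linarith
          calc _ = ENNReal.ofReal (Real.log (1 / P.real (X ⁻¹' {X ω})) + 1) := by
                rw [ENNReal.ofReal_add _ zero_le_one, ENNReal.ofReal_one]
                exact Real.log_nonneg (by rw [le_div_iff₀ hp]; linarith)
            _ ≤ ENNReal.ofReal (f (X ω) + Real.exp (-f (X ω)) / P.real (X ⁻¹' {X ω})) :=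
                ENNReal.ofReal_le_ofReal hlog
            _ ≤ _ := by
                rw [ENNReal.ofReal_add (hf _) (by positivity), ENNReal.ofReal_div_of_pos hp,
                  ofReal_measureReal]
                gcongr
      _ = ∫⁻ ω, ENNReal.ofReal (f (X ω)) ∂P + ∫⁻ ω, q (X ω) / P (X ⁻¹' {X ω}) ∂P :=
          lintegral_add_left (hm fun s => ENNReal.ofReal (f s)) _
      _ ≤ _ := by
          gcongr
          calc ∫⁻ ω, q (X ω) / P (X ⁻¹' {X ω}) ∂P
              = ∫⁻ s, q s / P (X ⁻¹' {s}) ∂(P.map X) :=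
                (lintegral_map (measurable_of_countable fun s => q s / P (X ⁻¹' {s})) hX).symm
            _ = ∑' s, q s / P (X ⁻¹' {s}) * P (X ⁻¹' {s}) := by
                rw [lintegral_countable']
                simp_rw [Measure.map_apply hX (measurableSet_singleton _)]
            _ ≤ ∑' s, q s := ENNReal.tsum_le_tsum fun s => by
                rw [ENNReal.div_eq_inv_mul, mul_right_comm]
                exact mul_le_of_le_one_left' (ENNReal.inv_mul_le_one _)
            _ ≤ 1 := hq
  exact (ENNReal.add_le_add_iff_right ENNReal.one_ne_top).1 hle

/-! ### The range of a trajectory -/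

theorem mem_walkRange {V : Type*} {n : ℕ} {ω : ℕ → V} {v : V} :
    v ∈ walkRange n ω ↔ ∃ i ≤ n, ω i = v := by
  simp [walkRange]

theorem walkRange_congr {V : Type*} {n : ℕ} {ω ω' : ℕ → V} (h : ∀ i ≤ n, ω i = ω' i) :
    walkRange n ω = walkRange n ω' := by
  ext v
  simp only [mem_walkRange]
  exact exists_congr fun i => and_congr_right fun hi => by rw [h i hi]

theorem walkRange_mono {V : Type*} {m n : ℕ} (h : m ≤ n) (ω : ℕ → V) :
    walkRange m ω ⊆ walkRange n ω := fun v hv => by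
  obtain ⟨i, hi, rfl⟩ := mem_walkRange.1 hv
  exact mem_walkRange.2 ⟨i, hi.trans h, rfl⟩

theorem measurableSet_preimage_walkRange {V : Type*} [Countable V] [MeasurableSpace V]
    [DiscreteMeasurableSpace V] (n : ℕ) (s : Set (Finset V)) :
    MeasurableSet (walkRange n ⁻¹' s : Set (ℕ → V)) := by
  classical
  have h : (walkRange n : (ℕ → V) → Finset V)
      = (fun y : Finset.Iic n → V => Finset.univ.image y) ∘ Preorder.frestrictLe n := by
    ext ω v
    simp [mem_walkRange]
  rw [h, Set.preimage_comp]
  exact (Set.to_countable _).measurableSet.preimage (Preorder.measurable_frestrictLe n)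

namespace SimpleGraph

variable {V : Type*} {G : SimpleGraph V}

/-! ### Walks in an infinite, locally finite graph -/

section Graph

theorem Connected.finite_setOf_dist_le [G.LocallyFinite] (hconn : G.Connected) (v : V) (n : ℕ) :
    {w | G.dist v w ≤ n}.Finite := by
  induction n with
  | zero =>
    refine (Set.finite_singleton v).subset fun w hw => ?_
    exact (hconn.dist_eq_zero_iff.1 (Nat.le_zero.1 hw)).symm
  | succ n ih =>
    refine (ih.union (ih.biUnion fun u _ => (G.neighborFinset u).finite_toSet)).subset
      fun w hw => ?_
    obtain ⟨p, hp⟩ := hconn.exists_walk_length_eq_dist w v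
    rw [dist_comm] at hp
    cases p with
    | nil => left; simp
    | @cons _ u _ hadj p =>
      right
      simp only [Set.mem_iUnion]
      refine ⟨u, ?_, by simpa using hadj.symm⟩
      have := dist_le p
      rw [Walk.length_cons] at hp
      rw [dist_comm] at this
      simp only [Set.mem_ofPred_eq] at hw ⊢
      omega

theorem Connected.countable [G.LocallyFinite] (hconn : G.Connected) : Countable V := by
  obtain ⟨v⟩ := hconn.nonempty
  rw [← Set.countable_univ_iff]
  refine (Set.countable_iUnion fun n => (hconn.finite_setOf_dist_le v n).countable).mono
    fun w _ => Set.mem_iUnion.2 ⟨G.dist v w, le_refl (G.dist v w)⟩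

theorem Connected.exists_isPath_length_ge [Infinite V] [G.LocallyFinite] (hconn : G.Connected)
    (v : V) (n : ℕ) : ∃ w, ∃ p : G.Walk v w, p.IsPath ∧ n ≤ p.length := by
  obtain ⟨w, hw⟩ := (hconn.finite_setOf_dist_le v n).exists_notMem
  obtain ⟨p, hp, hl⟩ := hconn.exists_path_of_dist v w
  exact ⟨w, p, hp, by simp only [Set.mem_ofPred_eq] at hw; omega⟩

/-- Balls are finite, so a self-avoiding path of length at least `k` leaves `x n`; its first `k + 1`
vertices already suffice for the count. -/
theorem Connected.exists_extension_card_gt [Infinite V] [G.LocallyFinite] (hconn : G.Connected)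
    (x : ℕ → V) (n k : ℕ) : ∃ y : ℕ → V, (∀ i ≤ n, y i = x i) ∧
      (∀ i < k, G.Adj (y (n + i)) (y (n + i + 1))) ∧ k < (walkRange (n + k) y).card := by
  classical
  obtain ⟨w, p, hp, hk⟩ := hconn.exists_isPath_length_ge (x n) k
  -- At `i = 0` the two branches agree, since the path starts at `x n`.
  have hy : ∀ i, (if n + i ≤ n then x (n + i) else p.getVert (n + i - n)) = p.getVert i := by
    intro i
    rcases i with _ | i
    · simp
    · simp
  refine ⟨fun i => if i ≤ n then x i else p.getVert (i - n), fun i hi => if_pos hi, ?_, ?_⟩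
  · intro i hi
    simp only [hy, add_assoc]
    exact p.adj_getVert_succ (by omega)
  · have hinj : Set.InjOn p.getVert (Finset.range (k + 1) : Set ℕ) := fun i hi j hj hij => by
      simp only [Finset.coe_range, Set.mem_Iio] at hi hj
      exact hp.getVert_injOn (show i ≤ _ by omega) (show j ≤ _ by omega) hij
    have hcard := Finset.card_image_of_injOn hinj
    rw [Finset.card_range] at hcard
    refine Nat.lt_of_succ_le (hcard.symm.le.trans (Finset.card_le_card fun v hv => ?_))
    obtain ⟨i, hi, rfl⟩ := Finset.mem_image.1 hv
    exact mem_walkRange.2 ⟨n + i, by simp at hi; omega, hy i⟩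

theorem Walk.exists_detour {o v x y : V} (p : G.Walk o v) (hx : x ∈ p.support) (h : G.Adj x y) :
    ∃ q : G.Walk o v, q.length = p.length + 2 ∧ ∀ u, u ∈ q.support ↔ u ∈ p.support ∨ u = y := by
  classical
  refine ⟨(p.takeUntil x hx).append (.cons h (.cons h.symm (p.dropUntil x hx))), ?_, fun u => ?_⟩
  · conv_rhs => rw [← p.take_spec hx]
    simp only [Walk.length_append, Walk.length_cons]
    omega
  · conv_rhs => rw [← p.take_spec hx]
    simp only [Walk.mem_support_append_iff, Walk.support_cons, List.mem_cons]
    have := (p.dropUntil x hx).start_mem_support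
    grind

/-- Each newly discovered vertex is inserted as a detour, one step there and one back, from the
vertex it was discovered from. The starting vertex costs nothing, hence the `- 1`. -/
theorem exists_walk_support_eq_walkRange {n : ℕ} {x : ℕ → V}
    (h : ∀ i < n, G.Adj (x i) (x (i + 1))) :
    ∃ v, ∃ p : G.Walk (x 0) v, p.length = 2 * ((walkRange n x).card - 1) ∧
      ∀ u, u ∈ p.support ↔ u ∈ walkRange n x := by
  classical
  induction n with
  | zero => exact ⟨_, .nil, by simp [walkRange], by simp [walkRange]⟩
  | succ n ih =>
    obtain ⟨v, p, hp, hs⟩ := ih fun i hi => h i (by omega)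
    have hins : walkRange (n + 1) x = insert (x (n + 1)) (walkRange n x) := by
      simp [walkRange, Finset.range_add_one, Finset.image_insert]
    by_cases hx : x (n + 1) ∈ walkRange n x
    · rw [hins, Finset.insert_eq_of_mem hx]
      exact ⟨v, p, hp, hs⟩
    · have hmem : x n ∈ walkRange n x := mem_walkRange.2 ⟨n, le_rfl, rfl⟩
      obtain ⟨q, hq, hqs⟩ := p.exists_detour ((hs _).2 hmem) (h n n.lt_succ_self)
      refine ⟨v, q, ?_, fun u => ?_⟩
      · have := Finset.card_pos.2 ⟨_, hmem⟩
        rw [hq, hp, hins, Finset.card_insert_of_notMem hx]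
        omega
      · rw [hqs, hs, hins, Finset.mem_insert, or_comm]

theorem Walk.walkRange_getVert {u v : V} (p : G.Walk u v) {s : Finset V}
    (h : ∀ w, w ∈ p.support ↔ w ∈ s) : walkRange p.length p.getVert = s := by
  ext w
  rw [← h, mem_walkRange, Walk.mem_support_iff_exists_getVert]
  exact exists_congr fun i => and_comm

end Graph

/-! ### Cylinder probabilities of the walk -/

section Law

variable [MeasurableSpace V] [DiscreteMeasurableSpace V] [G.LocallyFinite]

instance isProbabilityMeasure_walkLaw (o : V) : IsProbabilityMeasure (G.walkLaw o) := by
  unfold walkLaw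
  infer_instance

theorem inv_le_stepMeasure_singleton {d : ℕ} {x y : V} (hd : G.degree x ≤ d) (h : G.Adj x y) :
    (d : ℝ≥0∞)⁻¹ ≤ G.stepMeasure x {y} := by
  have h0 : G.degree x ≠ 0 := (G.degree_pos_iff_exists_adj x).2 ⟨y, h⟩ |>.ne'
  rw [stepMeasure, if_neg h0, Measure.finsetSum_apply]
  refine le_trans ?_ (Finset.single_le_sum (fun _ _ => zero_le) ((G.mem_neighborFinset x y).2 h))
  simpa using hd

theorem ae_adj_stepMeasure {x : V} (h : G.degree x ≠ 0) : ∀ᵐ y ∂G.stepMeasure x, G.Adj x y := by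
  rw [ae_iff, stepMeasure, if_neg h, Measure.finsetSum_apply]
  refine Finset.sum_eq_zero fun y hy => ?_
  simp [(G.mem_neighborFinset x y).1 hy]

/-- The Markov property, in the form from which the cylinder formulas follow. -/
theorem map_walkLaw (o : V) (n : ℕ) :
    (G.walkLaw o).map (fun ω => (Preorder.frestrictLe n ω, ω (n + 1)))
      = (G.walkLaw o).map (Preorder.frestrictLe (π := fun _ : ℕ => V) n) ⊗ₘ G.walkKernel n := by
  have := Kernel.partialTraj_compProd_eq_map_traj (X := fun _ : ℕ => V) (κ := G.walkKernel)
    (Nat.zero_le n) (x₀ := fun _ => o)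
  rw [walkLaw, ← this, Kernel.traj_map_frestrictLe_apply]

theorem ae_walkLaw_zero (o : V) : ∀ᵐ ω ∂G.walkLaw o, ω 0 = o := by
  have h := Kernel.traj_map_frestrictLe_apply (X := fun _ : ℕ => V) (κ := G.walkKernel) 0 0
    (fun _ => o)
  rw [Kernel.partialTraj_self, Kernel.id_apply] at h
  have hm : Measurable fun y : Finset.Iic 0 → V => y ⟨0, by simp⟩ := measurable_pi_apply _
  have h2 : ∀ᵐ y ∂((G.walkLaw o).map (Preorder.frestrictLe (π := fun _ : ℕ => V) 0)),
      y ⟨0, by simp⟩ = o := by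
    rw [walkLaw, h]
    exact (ae_dirac_iff (hm (MeasurableSet.of_discrete (s := {o})))).2 rfl
  exact ae_of_ae_map (Preorder.measurable_frestrictLe _).aemeasurable h2

variable [Countable V]

theorem ae_walkLaw_adj (hG : ∀ x, G.degree x ≠ 0) (o : V) :
    ∀ᵐ ω ∂G.walkLaw o, ∀ n, G.Adj (ω n) (ω (n + 1)) := by
  refine ae_all_iff.2 fun n => ?_
  have hm : Measurable fun ω : ℕ → V => (Preorder.frestrictLe (π := fun _ => V) n ω, ω (n + 1)) :=
    (Preorder.measurable_frestrictLe n).prodMk (measurable_pi_apply _)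
  have h : ∀ᵐ z ∂(G.walkLaw o).map (fun ω => (Preorder.frestrictLe n ω, ω (n + 1))),
      G.Adj (z.1 ⟨n, by simp⟩) z.2 := by
    rw [map_walkLaw]
    refine Measure.ae_compProd_of_ae_ae (Set.to_countable _).measurableSet ?_
    exact ae_of_all _ fun y => ae_adj_stepMeasure (hG _)
  exact ae_of_ae_map hm.aemeasurable h

theorem measurableSet_setOf_eqOn (n : ℕ) (x : ℕ → V) :
    MeasurableSet {ω : ℕ → V | ∀ i ≤ n, ω i = x i} := by
  measurability

theorem walkLaw_setOf_eqOn_succ (o : V) (n : ℕ) (x : ℕ → V) :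
    G.walkLaw o {ω | ∀ i ≤ n + 1, ω i = x i}
      = G.walkLaw o {ω | ∀ i ≤ n, ω i = x i} * G.stepMeasure (x n) {x (n + 1)} := by
  have hm : Measurable fun ω : ℕ → V => (Preorder.frestrictLe (π := fun _ => V) n ω, ω (n + 1)) :=
    (Preorder.measurable_frestrictLe n).prodMk (measurable_pi_apply _)
  have h := congrArg (fun μ => μ ({Preorder.frestrictLe n x} ×ˢ {x (n + 1)}))
    (map_walkLaw (G := G) o n)
  beta_reduce at h
  rw [Measure.map_apply hm (Set.to_countable _).measurableSet,
    Measure.compProd_apply_prod (measurableSet_singleton _) (measurableSet_singleton _),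
    lintegral_singleton, Measure.map_apply (Preorder.measurable_frestrictLe n)
      (measurableSet_singleton _)] at h
  have h1 : Preorder.frestrictLe (π := fun _ => V) n ⁻¹' {Preorder.frestrictLe n x}
      = {ω | ∀ i ≤ n, ω i = x i} := by
    ext ω
    simp [funext_iff]
  have h2 : (fun ω : ℕ → V => (Preorder.frestrictLe (π := fun _ => V) n ω, ω (n + 1))) ⁻¹'
      ({Preorder.frestrictLe n x} ×ˢ {x (n + 1)}) = {ω | ∀ i ≤ n + 1, ω i = x i} := by
    ext ω
    simp only [Set.mem_preimage, Set.mem_prod, Set.mem_singleton_iff, funext_iff,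
      Set.mem_ofPred_eq, Preorder.frestrictLe_apply, Subtype.forall, Finset.mem_Iic]
    constructor
    · rintro ⟨ha, hb⟩ i hi
      rcases Nat.le_succ_iff.1 hi with hi | rfl
      · exact ha i hi
      · exact hb
    · exact fun ha => ⟨fun i hi => ha i (by omega), ha _ le_rfl⟩
  rw [h1, h2] at h
  rw [h, mul_comm]
  rfl

theorem walkLaw_setOf_eqOn_mul_le {d : ℕ} (hd : ∀ x, G.degree x ≤ d) (o : V) (n k : ℕ)
    {x : ℕ → V} (h : ∀ i < k, G.Adj (x (n + i)) (x (n + i + 1))) :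
    G.walkLaw o {ω | ∀ i ≤ n, ω i = x i} * (d : ℝ≥0∞)⁻¹ ^ k
      ≤ G.walkLaw o {ω | ∀ i ≤ n + k, ω i = x i} := by
  induction k with
  | zero => simp
  | succ k ih =>
    rw [← add_assoc, walkLaw_setOf_eqOn_succ, pow_succ, ← mul_assoc]
    exact mul_le_mul' (ih fun i hi => h i (by omega))
      (inv_le_stepMeasure_singleton (hd _) (h k k.lt_succ_self))

theorem pow_le_walkLaw_walkRange {d : ℕ} (hd : ∀ x, G.degree x ≤ d) {o v : V} (p : G.Walk o v) :
    (d : ℝ≥0∞)⁻¹ ^ p.length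
      ≤ G.walkLaw o (walkRange p.length ⁻¹' {walkRange p.length p.getVert}) := by
  have h := walkLaw_setOf_eqOn_mul_le hd o 0 p.length (x := p.getVert) fun i hi => by
    simpa using p.adj_getVert_succ hi
  have h0 : G.walkLaw o {ω | ∀ i ≤ 0, ω i = p.getVert i} = 1 := by
    have := (prob_compl_eq_zero_iff (μ := G.walkLaw o)
      (measurableSet_setOf_eqOn 0 p.getVert)).1
    apply this
    have h1 := ae_walkLaw_zero (G := G) o
    rw [ae_iff] at h1
    simpa [Set.compl_ofPred] using h1
  rw [h0, one_mul, zero_add] at h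
  exact h.trans (measure_mono fun ω hω => walkRange_congr hω)

/-! ### The entropy bound -/

theorem rangeEntropy_le {d : ℕ} (hd1 : 1 ≤ d) (hd : ∀ x, G.degree x ≤ d)
    (hG : ∀ x, G.degree x ≠ 0) {ε : ℝ} (hε : 0 < ε) (n : ℕ) (o : V) :
    G.rangeEntropy n o ≤ ENNReal.ofReal (-Real.log (1 - Real.exp (-ε)))
      + ENNReal.ofReal (2 * Real.log d + ε) * G.expectedRange n o := by
  let _ : MeasurableSpace (Finset V) := ⊤
  have hmeas (m : ℕ) : Measurable (walkRange m : (ℕ → V) → Finset V) :=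
    fun s _ => measurableSet_preimage_walkRange m s
  have hr0 : 0 < Real.exp (-ε) := Real.exp_pos _
  have hr1 : Real.exp (-ε) < 1 := by simpa using hε
  have hd0 : (0 : ℝ) < d := by exact_mod_cast hd1
  have hlogd : 0 ≤ Real.log d := Real.log_natCast_nonneg d
  have hC : 0 ≤ -Real.log (1 - Real.exp (-ε)) :=
    neg_nonneg.2 (Real.log_nonpos (by linarith) (by linarith))
  set r : ℝ≥0∞ := ENNReal.ofReal (Real.exp (-ε)) with hr
  -- The geometric mixture over `k` is needed because the cardinality of the range is random. Its
  -- weight costs `ε` per vertex, its normalisation a constant.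
  let q : Finset V → ℝ≥0∞ := fun A =>
    ∑' k : ℕ, (1 - r) * r ^ k * G.walkLaw o (walkRange (2 * k) ⁻¹' {A})
  have hq : ∑' A, q A ≤ 1 := by
    rw [ENNReal.tsum_comm]
    have (k : ℕ) : ∑' A, (1 - r) * r ^ k * G.walkLaw o (walkRange (2 * k) ⁻¹' {A})
        = (1 - r) * r ^ k := by
      have hA : ∑' A : Finset V, G.walkLaw o (walkRange (2 * k) ⁻¹' {A}) = 1 := by
        have h1 := lintegral_countable' (μ := (G.walkLaw o).map (walkRange (2 * k)))
          (fun _ => (1 : ℝ≥0∞))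
        have h2 := Measure.isProbabilityMeasure_map (μ := G.walkLaw o)
          (hmeas (2 * k)).aemeasurable
        simp_rw [Measure.map_apply (hmeas _) (measurableSet_singleton _)] at h1
        simpa using h1.symm
      rw [ENNReal.tsum_mul_left, hA, mul_one]
    simp_rw [this]
    rw [ENNReal.tsum_mul_left, ENNReal.tsum_geometric]
    exact ENNReal.mul_inv_le_one _
  let f : Finset V → ℝ := fun A =>
    -Real.log (1 - Real.exp (-ε)) + (2 * Real.log d + ε) * A.card
  have hf (A : Finset V) : 0 ≤ f A := by positivity
  have hexp (A : Finset V) : ENNReal.ofReal (Real.exp (-f A))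
      = (1 - r) * r ^ A.card * (d : ℝ≥0∞)⁻¹ ^ (2 * A.card) := by
    have h1 : Real.exp (-f A)
        = (1 - Real.exp (-ε)) * Real.exp (-ε) ^ A.card * (d : ℝ)⁻¹ ^ (2 * A.card) := by
      have h2 : -f A = Real.log (1 - Real.exp (-ε)) + A.card * (-ε)
          + ((2 * A.card : ℕ) : ℝ) * (-Real.log d) := by
        simp only [f]; push_cast; ring
      rw [h2, Real.exp_add, Real.exp_add, Real.exp_log (by linarith), Real.exp_nat_mul,
        Real.exp_nat_mul, Real.exp_neg (Real.log d), Real.exp_log hd0]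
    rw [h1, ENNReal.ofReal_mul (by have := sub_pos.2 hr1; positivity),
      ENNReal.ofReal_mul (by linarith), ENNReal.ofReal_sub _ hr0.le, ENNReal.ofReal_one,
      ENNReal.ofReal_pow hr0.le, ENNReal.ofReal_pow (by positivity),
      ENNReal.ofReal_inv_of_pos hd0, ENNReal.ofReal_natCast]
  have hae : ∀ᵐ ω ∂G.walkLaw o,
      ENNReal.ofReal (Real.exp (-f (walkRange n ω))) ≤ q (walkRange n ω) := by
    filter_upwards [ae_walkLaw_zero (G := G) o, ae_walkLaw_adj hG o] with ω h0 hadj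
    obtain ⟨v, p, hp, hs⟩ := exists_walk_support_eq_walkRange (n := n) fun i _ => hadj i
    subst h0
    have hle := pow_le_walkLaw_walkRange hd p
    rw [p.walkRange_getVert hs, hp] at hle
    rw [hexp]
    set N := (walkRange n ω).card
    have hr1' : r ≤ 1 := ENNReal.ofReal_le_one.2 hr1.le
    have hd1' : (d : ℝ≥0∞)⁻¹ ≤ 1 := ENNReal.inv_le_one.2 (by exact_mod_cast hd1)
    -- Passing from `N - 1` to `N` only weakens the bound and makes `f` affine in the cardinality;
    -- then only the term `k = N - 1` of `q` is kept.
    calc (1 - r) * r ^ N * (d : ℝ≥0∞)⁻¹ ^ (2 * N)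
        ≤ (1 - r) * r ^ (N - 1) * (d : ℝ≥0∞)⁻¹ ^ (2 * (N - 1)) := by
          refine mul_le_mul' (mul_le_mul_right ?_ _) ?_
          · exact pow_le_pow_right_of_le_one' hr1' (Nat.sub_le _ _)
          · exact pow_le_pow_right_of_le_one' hd1' (by omega)
      _ ≤ (1 - r) * r ^ (N - 1) *
            G.walkLaw (ω 0) (walkRange (2 * (N - 1)) ⁻¹' {walkRange n ω}) := by gcongr
      _ ≤ q (walkRange n ω) := ENNReal.le_tsum (N - 1)
  refine (shannonEntropy_le_lintegral (G.walkLaw o) (hmeas n) hq hf hae).trans ?_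
  have hsplit (ω : ℕ → V) : ENNReal.ofReal (f (walkRange n ω))
      = ENNReal.ofReal (-Real.log (1 - Real.exp (-ε)))
        + ENNReal.ofReal (2 * Real.log d + ε) * ((walkRange n ω).card : ℝ≥0∞) := by
    rw [ENNReal.ofReal_add hC (by positivity), ENNReal.ofReal_mul (by positivity),
      ENNReal.ofReal_natCast]
  simp_rw [hsplit]
  rw [lintegral_add_left measurable_const, lintegral_const_mul' _ _ ENNReal.ofReal_ne_top]
  simp [expectedRange]

/-! ### Uniform growth of the expected range -/

/-- Given any past up to time `n`, the next `k` steps follow a fixed self-avoiding path with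
probability at least `d^{-k}`, and then more than `k` vertices have been seen. -/
theorem walkLaw_card_walkRange_add_le [Infinite V] {d : ℕ} (hd : ∀ x, G.degree x ≤ d)
    (hconn : G.Connected) (o : V) (n k : ℕ) :
    G.walkLaw o {ω | (walkRange (n + k) ω).card ≤ k}
      ≤ (1 - (d : ℝ≥0∞)⁻¹ ^ k) * G.walkLaw o {ω | (walkRange n ω).card ≤ k} := by
  have hfr : Measurable (Preorder.frestrictLe (π := fun _ : ℕ => V) n) :=
    Preorder.measurable_frestrictLe n
  have hB (m : ℕ) : MeasurableSet {ω : ℕ → V | (walkRange m ω).card ≤ k} :=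
    measurableSet_preimage_walkRange m {A | A.card ≤ k}
  have hsum (A : Set (ℕ → V)) : G.walkLaw o A = ∑' y : Finset.Iic n → V,
      G.walkLaw o (Preorder.frestrictLe (π := fun _ : ℕ => V) n ⁻¹' {y} ∩ A) := by
    have h1 := lintegral_countable' (μ := ((G.walkLaw o).restrict A).map
      (Preorder.frestrictLe (π := fun _ : ℕ => V) n)) (fun _ => (1 : ℝ≥0∞))
    simp_rw [Measure.map_apply hfr (measurableSet_singleton _),
      Measure.restrict_apply (hfr (measurableSet_singleton _))] at h1
    simpa [Measure.map_apply hfr MeasurableSet.univ] using h1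
  rw [hsum, hsum {ω | (walkRange n ω).card ≤ k}, ← ENNReal.tsum_mul_left]
  refine ENNReal.tsum_le_tsum fun y => ?_
  -- Values after time `n` are irrelevant; `o` is a filler.
  let x : ℕ → V := fun i => if h : i ∈ Finset.Iic n then y ⟨i, h⟩ else o
  have hx : Preorder.frestrictLe (π := fun _ : ℕ => V) n ⁻¹' {y} = {ω | ∀ i ≤ n, ω i = x i} := by
    ext ω
    simp only [Set.mem_preimage, Set.mem_singleton_iff, funext_iff, Preorder.frestrictLe_apply,
      Subtype.forall, Set.mem_ofPred_eq, Finset.mem_Iic, x]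
    exact forall_congr' fun i => forall_congr' fun hi => by rw [dif_pos hi]
  rw [hx]
  by_cases hc : (walkRange n x).card ≤ k
  · have hin : {ω : ℕ → V | ∀ i ≤ n, ω i = x i} ∩ {ω | (walkRange n ω).card ≤ k}
        = {ω | ∀ i ≤ n, ω i = x i} := Set.inter_eq_left.2 fun ω hω => by
      rw [Set.mem_ofPred_eq, walkRange_congr hω]
      exact hc
    obtain ⟨z, hzx, hadj, hz⟩ := hconn.exists_extension_card_gt x n k
    have hxz : {ω : ℕ → V | ∀ i ≤ n, ω i = x i} = {ω | ∀ i ≤ n, ω i = z i} := by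
      ext ω
      exact forall_congr' fun i => forall_congr' fun hi => by rw [hzx i hi]
    rw [hin, hxz]
    have hle := walkLaw_setOf_eqOn_mul_le hd o n k hadj
    calc _ ≤ G.walkLaw o ({ω | ∀ i ≤ n, ω i = z i} \ {ω | ∀ i ≤ n + k, ω i = z i}) := by
          refine measure_mono fun ω hω => ⟨hω.1, fun h => ?_⟩
          have := hω.2
          rw [Set.mem_ofPred_eq, walkRange_congr h] at this
          omega
      _ = G.walkLaw o {ω | ∀ i ≤ n, ω i = z i} - G.walkLaw o {ω | ∀ i ≤ n + k, ω i = z i} :=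
          measure_sdiff (fun ω hω i hi => hω i (by omega))
            (measurableSet_setOf_eqOn _ _).nullMeasurableSet (measure_ne_top _ _)
      _ ≤ G.walkLaw o {ω | ∀ i ≤ n, ω i = z i}
            - G.walkLaw o {ω | ∀ i ≤ n, ω i = z i} * (d : ℝ≥0∞)⁻¹ ^ k := tsub_le_tsub_left hle _
      _ = _ := by
          rw [ENNReal.sub_mul fun _ _ => measure_ne_top _ _, one_mul, mul_comm]
  · have hem : {ω : ℕ → V | ∀ i ≤ n, ω i = x i} ∩ {ω | (walkRange (n + k) ω).card ≤ k} = ∅ := by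
      rw [Set.eq_empty_iff_forall_notMem]
      rintro ω ⟨h1, h2⟩
      refine hc ?_
      rw [← walkRange_congr h1]
      exact (Finset.card_le_card (walkRange_mono (Nat.le_add_right n k) ω)).trans h2
    rw [hem, measure_empty]
    exact zero_le

/-- Over `j` blocks of `k` steps, the chance of seeing at most `k` vertices is at most `c ^ j`, with
`c < 1` independent of `o`. Once this is below `1/2`, Markov's inequality gives the bound. -/
theorem eventually_le_expectedRange [Infinite V] {d : ℕ} (hd : ∀ x, G.degree x ≤ d)
    (hconn : G.Connected) (k : ℕ) :
    ∀ᶠ n in atTop, ∀ o, (k : ℝ≥0∞) / 2 ≤ G.expectedRange n o := by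
  set c : ℝ≥0∞ := 1 - (d : ℝ≥0∞)⁻¹ ^ k
  have hc : c < 1 := ENNReal.sub_lt_self ENNReal.one_ne_top one_ne_zero (by simp)
  have hpow (j : ℕ) (o : V) : G.walkLaw o {ω | (walkRange (j * k) ω).card ≤ k} ≤ c ^ j := by
    induction j with
    | zero => simpa using prob_le_one
    | succ j ih =>
      rw [Nat.succ_mul, pow_succ']
      exact (walkLaw_card_walkRange_add_le hd hconn o (j * k) k).trans (by gcongr)
  obtain ⟨j, hj⟩ := ((ENNReal.tendsto_pow_atTop_nhds_zero_of_lt_one hc).eventually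
    (gt_mem_nhds (show (0 : ℝ≥0∞) < 2⁻¹ by simp))).exists
  filter_upwards [eventually_ge_atTop (j * k)] with n hn o
  have hB : MeasurableSet {ω : ℕ → V | (walkRange (j * k) ω).card ≤ k} :=
    measurableSet_preimage_walkRange _ {A | A.card ≤ k}
  have hhalf : (2 : ℝ≥0∞)⁻¹ ≤ G.walkLaw o {ω | (walkRange (j * k) ω).card ≤ k}ᶜ := by
    rw [prob_compl_eq_one_sub hB, ← ENNReal.one_sub_inv_two]
    exact tsub_le_tsub_left ((hpow j o).trans hj.le) _
  calc (k : ℝ≥0∞) / 2 ≤ k * G.walkLaw o {ω | (walkRange (j * k) ω).card ≤ k}ᶜ := by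
        rw [div_eq_mul_inv]; gcongr
    _ = ∫⁻ ω in {ω | (walkRange (j * k) ω).card ≤ k}ᶜ, (k : ℝ≥0∞) ∂G.walkLaw o := by simp
    _ ≤ ∫⁻ ω in {ω | (walkRange (j * k) ω).card ≤ k}ᶜ, ((walkRange n ω).card : ℝ≥0∞)
          ∂G.walkLaw o := by
        refine setLIntegral_mono' hB.compl fun ω hω => ?_
        have h1 := Finset.card_le_card (walkRange_mono hn ω)
        have h2 : k < (walkRange (j * k) ω).card := not_le.1 hω
        exact_mod_cast h2.le.trans h1
    _ ≤ G.expectedRange n o := setLIntegral_le_lintegral _ _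

end Law

end SimpleGraph

/-! ### Conclusion -/

theorem mainTheorem5 {V : Type*} [Infinite V] [MeasurableSpace V] [DiscreteMeasurableSpace V]
    (G : SimpleGraph V) [G.LocallyFinite] (hconn : G.Connected)
    (d : ℕ) (hd : ∀ x : V, G.degree x ≤ d) :
    limsup (fun n : ℕ => ⨆ o : V, G.rangeEntropy n o / G.expectedRange n o) atTop
      ≤ ENNReal.ofReal (2 * Real.log d) := by
  have hG (x : V) : G.degree x ≠ 0 := by
    obtain ⟨w, p, -, hp⟩ := hconn.exists_isPath_length_ge x 1
    exact ((G.degree_pos_iff_exists_adj x).2 ⟨p.getVert 1, by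
      simpa using p.adj_getVert_succ (i := 0) (by omega)⟩).ne'
  have hd1 : 1 ≤ d := by
    obtain ⟨x⟩ := hconn.nonempty
    exact (Nat.one_le_iff_ne_zero.2 (hG x)).trans (hd x)
  have := hconn.countable
  refine ENNReal.le_of_forall_pos_le_add fun δ hδ _ => ?_
  -- Half of `δ` is the `ε` of the entropy bound; the other half absorbs `C`, through `C ≤ ε k / 2 ≤
  -- ε E_o |R_n|`.
  set ε : ℝ := δ / 2
  have hε : 0 < ε := by positivity
  set C := ENNReal.ofReal (-Real.log (1 - Real.exp (-ε)))
  obtain ⟨k, hk⟩ := ENNReal.exists_nat_gt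
    (show 2 * C / ENNReal.ofReal ε ≠ ∞ from
      ENNReal.div_ne_top (ENNReal.mul_ne_top (by simp) ENNReal.ofReal_ne_top) (by simpa using hε))
  refine limsup_le_of_le (by isBoundedDefault) ?_
  filter_upwards [SimpleGraph.eventually_le_expectedRange hd hconn (k + 1)] with n hn
  refine iSup_le fun o => ?_
  have hm := hn o
  have hm0 : G.expectedRange n o ≠ 0 := by
    intro h0
    rw [h0] at hm
    simp at hm
  have hCm : C ≤ ENNReal.ofReal ε * G.expectedRange n o := by
    rw [ENNReal.div_lt_iff (by simp [hε]) (by simp)] at hk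
    have h1 : C ≤ ENNReal.ofReal ε * ((k : ℝ≥0∞) / 2) := by
      rw [← mul_div_assoc, ENNReal.le_div_iff_mul_le (by simp) (by simp), mul_comm C,
        mul_comm _ (k : ℝ≥0∞)]
      exact hk.le
    refine h1.trans (mul_le_mul_right (le_trans ?_ hm) _)
    gcongr
    simp
  refine ENNReal.div_le_of_le_mul ((SimpleGraph.rangeEntropy_le hd1 hd hG hε n o).trans ?_)
  have hlogd : 0 ≤ Real.log d := Real.log_natCast_nonneg d
  have hδ2 : (δ : ℝ≥0∞) = ENNReal.ofReal ε + ENNReal.ofReal ε := by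
    rw [← ENNReal.ofReal_add hε.le hε.le, add_halves, ENNReal.ofReal_coe_nnreal]
  calc _ ≤ ENNReal.ofReal ε * G.expectedRange n o
        + ENNReal.ofReal (2 * Real.log d + ε) * G.expectedRange n o := by gcongr
    _ = _ := by
      rw [ENNReal.ofReal_add (by positivity) hε.le, hδ2]
      ring
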